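/- For $k\ge 1$ write $\mathbb{Q}_k=\mathbb{Q}(e^{2\pi i/k})\subseteq\mathbb{C}$. Let $p$ be a prime, and let $F\subseteq\mathbb{C}$ be an abelian number field with conductor $n$, that is, $n$ is the smallest positive integer with $\mathbb{Q}\subseteq F\subseteq\mathbb{Q}_n$. Write $n=p^a m$, where $p$ does not divide $m$. If the degree $|\mathbb{Q}_n:\langle F,\mathbb{Q}_m\rangle|$ is not divisible by $p$ (where $\langle F,\mathbb{Q}_m\rangle$ is the compositum), then there exist a finite solvable group $G$ and an irreducible complex character $\chi\in\mathrm{Irr}(G)$ of $p$-height zero such that $\mathbb{Q}(\chi)=F$. Here $\mathbb{Q}(\chi)$ is the field generated over $\mathbb{Q}$ by the values of $\chi$, and $\chi$ has $p$-height zero if the $p$-part of $\chi(1)$ is the minimum of the $p$-parts of the degrees $\psi(1)$ of the irreducible characters $\psi$ in the $p$-block of $\chi$. -/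

import Mathlib

namespace HeightZero

/-- The cyclotomic field `ℚ_n = ℚ(e^{2πi/n})`, as a subfield of `ℂ`. -/
noncomputable def cyclotomicSubfield (n : ℕ) : IntermediateField ℚ ℂ :=
  IntermediateField.adjoin ℚ {Complex.exp (2 * Real.pi * Complex.I / n)}

/-- `n` is the conductor of `F`: the smallest positive integer with `F ⊆ ℚ_n`. -/
def IsConductor (F : IntermediateField ℚ ℂ) (n : ℕ) : Prop :=
  IsLeast {k : ℕ | 0 < k ∧ F ≤ cyclotomicSubfield k} n

/-- `χ` is the character of an irreducible complex representation of `G` of dimension `d`. -/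
def IsIrreducibleCharacterOfDegree {G : Type*} [Group G] (χ : G → ℂ) (d : ℕ) : Prop :=
  ∃ ρ : Representation ℂ G (Fin d → ℂ), ρ.IsIrreducible ∧ χ = ρ.character

/-- `Irr(G)`, the irreducible complex characters of `G`. -/
def Irr (G : Type*) [Group G] : Type _ :=
  {χ : G → ℂ // ∃ d : ℕ, IsIrreducibleCharacterOfDegree χ d}

namespace Irr

variable {G : Type*} [Group G]

instance : CoeFun (Irr G) (fun _ => G → ℂ) := ⟨Subtype.val⟩

/-- The degree `χ(1)` of an irreducible character, as a natural number. -/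
noncomputable def degree (χ : Irr G) : ℕ := χ.2.choose

theorem apply_one (χ : Irr G) : χ 1 = (χ.degree : ℂ) := by
  obtain ⟨ρ, -, h⟩ := χ.2.choose_spec
  rw [h, Representation.char_one]
  simp [degree]

/-- The field of values `ℚ(χ)`. -/
noncomputable def fieldOfValues (χ : Irr G) : IntermediateField ℚ ℂ :=
  IntermediateField.adjoin ℚ (Set.range (χ : G → ℂ))

/-- The value `ω_χ(K̂) = |K| χ(g) / χ(1)` of the central character of `χ` at the sum `K̂` of the
conjugacy class `K` of `g`. -/
noncomputable def centralCharacter (χ : Irr G) (g : G) : ℂ :=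
  ({h : G | IsConj g h}.ncard : ℂ) * χ g / χ 1

/-- The irreducible characters in the `p`-block of `χ`, computed with a maximal ideal `M`
(containing `p`) of the ring of all algebraic integers: those `ψ` with
`ω_ψ(K̂) ≡ ω_χ(K̂)` modulo `M` for every conjugacy class `K`. -/
def block (M : Ideal (integralClosure ℤ ℂ)) (χ : Irr G) : Set (Irr G) :=
  {ψ | ∀ g : G, ∃ z ∈ M, (z : ℂ) = χ.centralCharacter g - ψ.centralCharacter g}

theorem mem_block_self (M : Ideal (integralClosure ℤ ℂ)) (χ : Irr G) : χ ∈ χ.block M :=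
  fun _ => ⟨0, M.zero_mem, by simp⟩

/-- The height of `χ` in its `p`-block `B`: the `h` with
`χ(1)_p = p ^ h * min {ψ(1)_p | ψ ∈ Irr(B)}`. -/
noncomputable def height (p : ℕ) (M : Ideal (integralClosure ℤ ℂ)) (χ : Irr G) : ℕ :=
  padicValNat p χ.degree - sInf ((fun ψ : Irr G => padicValNat p ψ.degree) '' χ.block M)

/-- The subtraction in `height` does not truncate. -/
theorem height_add (p : ℕ) (M : Ideal (integralClosure ℤ ℂ)) (χ : Irr G) :
    χ.height p M + sInf ((fun ψ : Irr G => padicValNat p ψ.degree) '' χ.block M) =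
      padicValNat p χ.degree :=
  Nat.sub_add_cancel (Nat.sInf_le ⟨χ, χ.mem_block_self M, rfl⟩)

/-- `χ` has `p`-height zero. The `p`-blocks do not depend on the choice of the maximal ideal above
`p`; height zero is required for every choice. -/
def HasHeightZero (p : ℕ) (χ : Irr G) : Prop :=
  ∀ M : Ideal (integralClosure ℤ ℂ), M.IsMaximal → (p : integralClosure ℤ ℂ) ∈ M →
    χ.height p M = 0

end Irr

/-- There are maximal ideals above `p` in the ring of algebraic integers. -/
theorem exists_isMaximal_mem (p : ℕ) (hp : p.Prime) :
    ∃ M : Ideal (integralClosure ℤ ℂ), M.IsMaximal ∧ (p : integralClosure ℤ ℂ) ∈ M := by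
  have hmax : (Ideal.span {(p : ℤ)}).IsMaximal :=
    PrincipalIdealRing.isMaximal_of_irreducible (Nat.prime_iff_prime_int.mp hp).irreducible
  obtain ⟨M, hM, hc⟩ := Ideal.exists_ideal_over_maximal_of_isIntegral
    (S := integralClosure ℤ ℂ) (Ideal.span {(p : ℤ)}) (by
      rw [(RingHom.injective_iff_ker_eq_bot _).mp
        (FaithfulSMul.algebraMap_injective ℤ (integralClosure ℤ ℂ))]
      exact bot_le)
  refine ⟨M, hM, ?_⟩
  have : (p : ℤ) ∈ M.comap (algebraMap ℤ (integralClosure ℤ ℂ)) := by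
    rw [hc]; exact Ideal.mem_span_singleton_self _
  simpa using this

end HeightZero

/-!
Write `H` for the subgroup of `(ℤ/n)ˣ` corresponding to the Galois group of `ℚ_n` over `F`. The
group is the semidirect product `G = ℤ/n ⋊ H` with `H` acting by multiplication, which is metabelian,
and `χ` is induced from a faithful linear character of `ℤ/n`. Distinct elements of `H` give distinct
conjugates of this linear character, so `χ` is irreducible, of degree `|H|`.

*Field of values.* The values of `χ` are zero and the Gaussian periods `∑ t ∈ H, e(tx / n)`. They lie
in `F`, and an automorphism of `ℚ_n` fixing all of them belongs to `H` because distinct characters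
of `ℤ/n` are linearly independent; by Galois theory they generate `F`
(`fieldOfValues_inducedRep`).

*Height.* Let `N` be the subgroup of order `m` in `ℤ/n`. It is normal in `G` of order prime to `p`,
and `G` acts on it through the image `T` of `H` in `(ℤ/m)ˣ`. By Schur's lemma the central character
of an irreducible character at a class in `N` is a sum of values of any linear constituent of its
restriction to `N` (`centralCharacter_eq_sum`). Comparing these modulo a maximal ideal above `p`, and
using that `m` is a unit there, shows that all characters in the block of `χ` lie over the `G`-orbit
of a single faithful character of `N` (`weight_mem_range_of_congr`). By Clifford's theorem `|T|`
divides their degrees (`card_range_dvd_finrank`). On the other hand `χ(1) = |H| = |T| |K|`, where the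
kernel `K` of `H → (ℤ/m)ˣ` embeds in the Galois group of `ℚ_n` over `⟨F, ℚ_m⟩`
(`card_ker_dvd_relfinrank`) and therefore has order prime to `p`.
-/

/-! ### Weights of a representation on a normal cyclic subgroup -/

namespace HeightZero

open Module Multiplicative ZMod

section Weights

variable {G V : Type*} [Group G] [AddCommGroup V] [Module ℂ V] {m : ℕ} [NeZero m]

/-- The weight space of a representation `ρ` of `G` for the character `j ↦ e(yj / m)` of the cyclic
group `ℤ/m`, mapped to `G` by `c`. It is encoded as the eigenspace of a generator. -/
noncomputable def weightSpace (ρ : Representation ℂ G V) (c : Multiplicative (ZMod m) →* G)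
    (y : ZMod m) : Submodule ℂ V :=
  End.eigenspace (ρ (c (ofAdd 1))) (stdAddChar y)

variable {ρ : Representation ℂ G V} {c : Multiplicative (ZMod m) →* G} {π : G →* (ZMod m)ˣ}

theorem apply_of_mem_weightSpace {y : ZMod m} {v : V} (hv : v ∈ weightSpace ρ c y) (j : ZMod m) :
    ρ (c (ofAdd j)) v = (stdAddChar (y * j) : ℂ) • v := by
  obtain ⟨k, rfl⟩ := ZMod.natCast_zmod_surjective j
  induction k with
  | zero => simp
  | succ k ih =>
    rw [weightSpace, End.mem_eigenspace_iff] at hv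
    rw [Nat.cast_succ, ofAdd_add, map_mul, map_mul, Module.End.mul_apply, hv, _root_.map_smul, ih,
      smul_smul, mul_add, mul_one, AddChar.map_add_eq_mul, mul_comm]

theorem exists_weightSpace_ne_bot [FiniteDimensional ℂ V] [Nontrivial V]
    (ρ : Representation ℂ G V) (c : Multiplicative (ZMod m) →* G) :
    ∃ y, weightSpace ρ c y ≠ ⊥ := by
  obtain ⟨μ, hμ⟩ := End.exists_eigenvalue (ρ (c (ofAdd 1)))
  obtain ⟨v, hv⟩ := hμ.exists_hasEigenvector
  have hpow : ρ (c (ofAdd 1)) ^ m = 1 := by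
    rw [← map_pow, ← map_pow, ← ofAdd_nsmul]
    simp
  have h1 : μ ^ m = 1 := by
    have h2 := hv.pow_apply m
    rw [hpow] at h2
    have h3 : (μ ^ m - 1) • v = 0 := by
      rw [sub_smul, ← h2]; simp
    exact sub_eq_zero.mp ((smul_eq_zero.mp h3).resolve_right hv.2)
  obtain ⟨i, -, hi⟩ := (Complex.isPrimitiveRoot_exp m (NeZero.ne m)).eq_pow_of_pow_eq_one h1
  refine ⟨(i : ZMod m), ?_⟩
  have h4 : (stdAddChar (i : ZMod m) : ℂ) = μ := by
    have := stdAddChar_coe (N := m) (i : ℤ)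
    push_cast at this
    rw [this, ← hi, ← Complex.exp_nat_mul]
    congr 1
    ring
  rw [weightSpace, h4]
  exact hμ

theorem iSupIndep_weightSpace (ρ : Representation ℂ G V) (c : Multiplicative (ZMod m) →* G) :
    iSupIndep (weightSpace ρ c) :=
  (End.eigenspaces_iSupIndep (ρ (c (ofAdd 1)))).comp injective_stdAddChar

section Conj

variable (hconj : ∀ g j, g * c (ofAdd j) * g⁻¹ = c (ofAdd (π g * j)))
include hconj

theorem apply_mem_weightSpace {y : ZMod m} {v : V} (hv : v ∈ weightSpace ρ c y) (g : G) :
    ρ g v ∈ weightSpace ρ c (y * ((π g)⁻¹ : (ZMod m)ˣ)) := by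
  have h : c (ofAdd 1) * g = g * c (ofAdd (((π g)⁻¹ : (ZMod m)ˣ) : ZMod m)) := by
    rw [← Units.mul_inv (π g), ← hconj]
    group
  rw [weightSpace, End.mem_eigenspace_iff, ← Module.End.mul_apply, ← map_mul, h, map_mul,
    Module.End.mul_apply, apply_of_mem_weightSpace hv, _root_.map_smul]

theorem finrank_weightSpace_le [FiniteDimensional ℂ V] (y : ZMod m) (g : G) :
    finrank ℂ (weightSpace ρ c y) ≤
      finrank ℂ (weightSpace ρ c (y * ((π g)⁻¹ : (ZMod m)ˣ))) := by
  have hinj : Function.Injective (ρ g) := (ρ.apply_bijective g).injective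
  refine (LinearEquiv.finrank_eq (Submodule.equivMapOfInjective _ hinj _)).trans_le
    (Submodule.finrank_mono ?_)
  rintro _ ⟨v, hv, rfl⟩
  exact apply_mem_weightSpace hconj hv g

theorem finrank_weightSpace_eq [FiniteDimensional ℂ V] (g : G) :
    finrank ℂ (weightSpace ρ c (π g : ZMod m)) = finrank ℂ (weightSpace ρ c 1) := by
  apply le_antisymm
  · have h := finrank_weightSpace_le (ρ := ρ) hconj (π g : ZMod m) g
    rwa [Units.mul_inv] at h
  · have h := finrank_weightSpace_le (ρ := ρ) hconj 1 g⁻¹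
    rwa [map_inv, inv_inv, one_mul] at h

/-- The weight spaces in the orbit of a weight that occurs span an irreducible representation. -/
theorem iSup_weightSpace_eq_top (hρ : ρ.IsIrreducible) (h1 : weightSpace ρ c 1 ≠ ⊥) :
    ⨆ t : π.range, weightSpace ρ c (t : (ZMod m)ˣ) = ⊤ := by
  let S : Subrepresentation ρ :=
    { toSubmodule := ⨆ t : π.range, weightSpace ρ c (t : (ZMod m)ˣ)
      apply_mem_toSubmodule := by
        intro g v hv
        refine Submodule.iSup_induction _ (motive := fun v => ρ g v ∈ _) hv ?_ ?_ ?_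
        · intro t x hx
          refine Submodule.mem_iSup_of_mem (t * ⟨(π g)⁻¹, ⟨g⁻¹, map_inv π g⟩⟩) ?_
          simpa using apply_mem_weightSpace hconj hx g
        · simp
        · intro x y hx hy
          rw [map_add]
          exact Submodule.add_mem _ hx hy }
  have hS : S = ⊥ ∨ S = ⊤ := hρ.eq_bot_or_eq_top S
  rcases hS with hS | hS
  · refine absurd ?_ h1
    have : S.toSubmodule = ⊥ := by rw [hS]; rfl
    rw [eq_bot_iff, ← this]
    exact (le_of_eq (by simp)).trans
      (le_iSup (fun t : π.range => weightSpace ρ c (t : (ZMod m)ˣ)) 1)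
  · exact congrArg Subrepresentation.toSubmodule hS

/-- Clifford's theorem for the weights: the orbit of a weight has a length dividing the dimension. -/
theorem card_range_dvd_finrank [FiniteDimensional ℂ V] (hρ : ρ.IsIrreducible)
    (h1 : weightSpace ρ c 1 ≠ ⊥) : Nat.card π.range ∣ finrank ℂ V := by
  classical
  have hinj : Function.Injective (fun t : π.range => ((t : (ZMod m)ˣ) : ZMod m)) :=
    Units.val_injective.comp Subtype.val_injective
  have hint := DirectSum.isInternal_submodule_of_iSupIndep_of_iSup_eq_top
    ((iSupIndep_weightSpace ρ c).comp hinj) (iSup_weightSpace_eq_top hconj hρ h1)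
  rw [← (LinearEquiv.ofBijective (DirectSum.coeLinearMap _) hint).finrank_eq, finrank_directSum,
    Finset.sum_congr rfl (g := fun _ => finrank ℂ (weightSpace ρ c 1))]
  · simp
  · rintro ⟨_, g, rfl⟩ -
    exact finrank_weightSpace_eq hconj g

/-- Schur's lemma for a class sum in the normal cyclic subgroup: the scalar by which it acts is
read off on any weight vector. -/
theorem centralCharacter_eq_sum [FiniteDimensional ℂ V] (hc : Function.Injective c)
    (hρ : ρ.IsIrreducible) {y : ZMod m} (hy : weightSpace ρ c y ≠ ⊥) (k : ZMod m)
    [DecidablePred fun j : ZMod m => IsConj (c (ofAdd k)) (c (ofAdd j))] :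
    ({h : G | IsConj (c (ofAdd k)) h}.ncard : ℂ) * ρ.character (c (ofAdd k)) / ρ.character 1 =
      ∑ j with IsConj (c (ofAdd k)) (c (ofAdd j)), (stdAddChar (y * j) : ℂ) := by
  set O : Finset (ZMod m) := {j | IsConj (c (ofAdd k)) (c (ofAdd j))} with hO
  have hcard : {h : G | IsConj (c (ofAdd k)) h}.ncard = O.card := by
    have himg : {h : G | IsConj (c (ofAdd k)) h} = (fun j => c (ofAdd j)) '' (O : Set (ZMod m)) := by
      ext h
      constructor
      · rintro hh
        obtain ⟨g, rfl⟩ := isConj_iff.mp hh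
        exact ⟨π g * k, by simp [hO, ← hconj], (hconj g k).symm⟩
      · rintro ⟨j, hj, rfl⟩
        simpa [hO] using hj
    have hinj : Function.Injective fun j => c (ofAdd j) := hc.comp ofAdd.injective
    rw [himg, Set.ncard_image_of_injective _ hinj, Set.ncard_coe_finset]
  set s : ℂ := ∑ j ∈ O, (stdAddChar (y * j) : ℂ)
  set Z : V →ₗ[ℂ] V := ∑ j ∈ O, ρ (c (ofAdd j)) with hZ
  have hcomm (g : G) : Z * ρ g = ρ g * Z := by
    have h2 : ρ g * Z = ∑ j ∈ O, ρ (c (ofAdd (π g * j))) * ρ g := by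
      rw [hZ, Finset.mul_sum]
      refine Finset.sum_congr rfl fun j _ => ?_
      rw [← map_mul, ← map_mul, ← hconj]
      congr 1
      group
    rw [h2, hZ, ← Finset.sum_mul]
    congr 1
    symm
    refine Finset.sum_equiv (Units.mulLeft (π g)) (fun j => ?_) (fun j _ => rfl)
    have h3 : IsConj (c (ofAdd j)) (c (ofAdd (π g * j))) := isConj_iff.mpr ⟨g, hconj g j⟩
    simp only [hO, Finset.mem_filter, Finset.mem_univ, true_and, Units.mulLeft_apply]
    exact ⟨fun h => h.trans h3, fun h => h.trans h3.symm⟩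
  obtain ⟨v, hv, hv0⟩ := Submodule.exists_mem_ne_zero_of_ne_bot hy
  have hZv : Z v = s • v := by
    rw [hZ, LinearMap.sum_apply, Finset.sum_smul]
    exact Finset.sum_congr rfl fun j _ => apply_of_mem_weightSpace hv j
  let S : Subrepresentation ρ :=
    { toSubmodule := End.eigenspace Z s
      apply_mem_toSubmodule := by
        intro g w hw
        rw [End.mem_eigenspace_iff] at hw ⊢
        rw [← Module.End.mul_apply, hcomm, Module.End.mul_apply, hw, _root_.map_smul] }
  have hZs : Z = s • LinearMap.id := by
    rcases hρ.eq_bot_or_eq_top S with hS | hS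
    · have hvS : v ∈ S.toSubmodule := End.mem_eigenspace_iff.mpr hZv
      rw [hS] at hvS
      exact absurd ((Submodule.mem_bot ℂ).mp hvS) hv0
    · ext w
      have hw : w ∈ S.toSubmodule := by rw [hS]; exact Submodule.mem_top
      simpa using End.mem_eigenspace_iff.mp hw
  have htr : LinearMap.trace ℂ V Z = O.card * ρ.character (c (ofAdd k)) := by
    rw [hZ, map_sum, ← nsmul_eq_mul]
    refine Finset.sum_eq_card_nsmul fun j hj => ?_
    obtain ⟨g, hg⟩ := isConj_iff.mp (Finset.mem_filter.mp hj).2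
    rw [← hg]
    exact ρ.char_conj _ _
  have hpos : ρ.character 1 ≠ 0 := by
    have : Nontrivial V := ⟨v, 0, hv0⟩
    rw [Representation.char_one]
    exact_mod_cast (finrank_pos (R := ℂ) (M := V)).ne'
  rw [hcard, ← htr, hZs, div_eq_iff hpos, Representation.char_one]
  simp

end Conj

end Weights

theorem isIntegral_stdAddChar {m : ℕ} [NeZero m] (j : ZMod m) :
    IsIntegral ℤ (stdAddChar j : ℂ) := by
  refine IsIntegral.of_pow (NeZero.pos m) ?_
  rw [← AddChar.map_nsmul_eq_pow]
  simp [isIntegral_one]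

/-- Irreducible characters in the same `p`-block lie over the same orbit of weights of a normal
cyclic subgroup of order prime to `p`. -/
theorem weight_mem_range_of_congr {G V W : Type*} [Group G] [AddCommGroup V] [Module ℂ V]
    [AddCommGroup W] [Module ℂ W] [FiniteDimensional ℂ V] [FiniteDimensional ℂ W]
    {m : ℕ} [NeZero m] {c : Multiplicative (ZMod m) →* G} {π : G →* (ZMod m)ˣ}
    (hconj : ∀ g j, g * c (ofAdd j) * g⁻¹ = c (ofAdd (π g * j))) (hc : Function.Injective c)
    {ρ : Representation ℂ G V} {τ : Representation ℂ G W}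
    (hρ : ρ.IsIrreducible) (hτ : τ.IsIrreducible)
    {M : Ideal (integralClosure ℤ ℂ)} (hM : M.IsMaximal) {p : ℕ} (hp : p.Prime) (hpm : ¬ p ∣ m)
    (hpM : (p : integralClosure ℤ ℂ) ∈ M)
    (hcongr : ∀ g : G, ∃ z ∈ M, (z : ℂ) =
      ({h : G | IsConj g h}.ncard : ℂ) * ρ.character g / ρ.character 1 -
      ({h : G | IsConj g h}.ncard : ℂ) * τ.character g / τ.character 1)
    (h1 : weightSpace ρ c 1 ≠ ⊥) {y : ZMod m} (hy : weightSpace τ c y ≠ ⊥) :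
    ∃ g, (π g : ZMod m) = y := by
  classical
  by_contra! hne
  let E (j : ZMod m) : integralClosure ℤ ℂ := ⟨stdAddChar j, isIntegral_stdAddChar j⟩
  have hE (j k : ZMod m) : E j * E k = E (j + k) :=
    Subtype.ext (AddChar.map_add_eq_mul _ _ _).symm
  have hEsum (a : ZMod m) : ∑ j, E (j * a) = if a = 0 then (m : integralClosure ℤ ℂ) else 0 := by
    apply Subtype.ext
    have := AddChar.sum_mulShift a (isPrimitive_stdAddChar m)
    rw [ZMod.card] at this
    rw [apply_ite Subtype.val, AddSubmonoidClass.coe_finsetSum, this]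
    push_cast
    simp
  have hclass (k : ZMod m) :
      ∑ j with IsConj (c (ofAdd k)) (c (ofAdd j)), (E j - E (y * j)) ∈ M := by
    obtain ⟨z, hz, hzeq⟩ := hcongr (c (ofAdd k))
    rw [centralCharacter_eq_sum hconj hc hρ h1, centralCharacter_eq_sum hconj hc hτ hy] at hzeq
    convert hz
    apply Subtype.ext
    rw [hzeq]
    simp [E]
  -- The coefficients of `m` times the central idempotent attached to the orbit of the weight `1`.
  let f (j : ZMod m) : integralClosure ℤ ℂ := ∑ t : π.range, E (-((t : (ZMod m)ˣ) * j))
  have hf (k j : ZMod m) (h : IsConj (c (ofAdd k)) (c (ofAdd j))) : f j = f k := by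
    obtain ⟨g, hg⟩ := isConj_iff.mp h
    rw [hconj] at hg
    have hj : π g * k = j := ofAdd.injective (hc hg)
    let s : π.range := ⟨π g, g, rfl⟩
    refine Fintype.sum_equiv (Equiv.mulRight s) _ _ fun t => ?_
    simp [s, ← hj, mul_assoc]
  have hsum : ∑ j, f j * (E j - E (y * j)) ∈ M := by
    rw [← Finset.sum_fiberwise_of_maps_to (t := Finset.univ.image fun j =>
      ConjClasses.mk (c (ofAdd j))) (g := fun j => ConjClasses.mk (c (ofAdd j)))
      (fun j hj => Finset.mem_image_of_mem _ hj)]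
    refine M.sum_mem fun C hC => ?_
    obtain ⟨k, -, rfl⟩ := Finset.mem_image.mp hC
    have hfilter : (Finset.univ.filter fun j =>
        ConjClasses.mk (c (ofAdd j)) = ConjClasses.mk (c (ofAdd k))) =
        Finset.univ.filter fun j => IsConj (c (ofAdd k)) (c (ofAdd j)) := by
      ext j
      rw [Finset.mem_filter, Finset.mem_filter, ConjClasses.mk_eq_mk_iff_isConj, isConj_comm]
    rw [hfilter, Finset.sum_congr rfl (g := fun j => f k * (E j - E (y * j)))
      (fun j hj => by rw [hf k j (Finset.mem_filter.mp hj).2]), ← Finset.mul_sum]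
    exact M.mul_mem_left _ (hclass k)
  have hval (a : ZMod m) : ∑ j, f j * E (a * j) =
      ∑ t : π.range, if a = (t : (ZMod m)ˣ) then (m : integralClosure ℤ ℂ) else 0 := by
    simp only [f, Finset.sum_mul]
    rw [Finset.sum_comm]
    refine Finset.sum_congr rfl fun t _ => ?_
    simp only [← sub_eq_zero (a := a), ← hEsum]
    refine Finset.sum_congr rfl fun j _ => ?_
    rw [hE]
    congr 1
    ring
  have hm : ∑ j, f j * (E j - E (y * j)) = m := by
    simp only [mul_sub, Finset.sum_sub_distrib, hval]
    have h0 := hval 1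
    simp only [one_mul] at h0
    rw [h0, Finset.sum_eq_single 1, Finset.sum_eq_zero]
    · simp
    · rintro ⟨_, g, rfl⟩ -
      exact if_neg (hne g).symm
    · intro t _ ht
      refine if_neg fun h => ht ?_
      exact Subtype.ext (Units.ext (by simpa using h.symm))
    · simp
  rw [hm] at hsum
  refine hM.ne_top ((Ideal.eq_top_iff_one M).mpr ?_)
  obtain ⟨u, v, huv⟩ := Nat.isCoprime_iff_coprime.mpr ((hp.coprime_iff_not_dvd).mpr hpm)
  have := congrArg (fun z : ℤ => (z : integralClosure ℤ ℂ)) huv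
  push_cast at this
  rw [← this]
  exact M.add_mem (M.mul_mem_left _ hpM) (M.mul_mem_left _ hsum)

end HeightZero

/-! ### The character induced from a faithful character of a cyclic group -/

namespace HeightZero

open Module Multiplicative ZMod

section SemidirectProduct

variable {n : ℕ} (H : Subgroup (ZMod n)ˣ)

/-- The action of a group of units of `ℤ/n` on the additive group by multiplication. -/
def unitAction : H →* MulAut (Multiplicative (ZMod n)) where
  toFun u := AddEquiv.toMultiplicative (AddAut.mulLeft (u : (ZMod n)ˣ))
  map_one' := by
    ext x
    exact congrArg ofAdd (one_mul (toAdd x))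
  map_mul' u v := by
    ext x
    exact congrArg ofAdd (mul_assoc ((u : (ZMod n)ˣ) : ZMod n) ((v : (ZMod n)ˣ) : ZMod n) (toAdd x))

theorem toAdd_unitAction (u : H) (x : Multiplicative (ZMod n)) :
    toAdd (unitAction H u x) = ((u : (ZMod n)ˣ) : ZMod n) * toAdd x := rfl

/-- The semidirect product of `ℤ/n` with a group of units acting by multiplication. -/
abbrev AffineGroup : Type := Multiplicative (ZMod n) ⋊[unitAction H] H

variable [NeZero n] {H} {ι : Type*} (ε : ι ≃ H)

/-- The representation of `ℤ/n ⋊ H` induced from the character `x ↦ e(x / n)` of `ℤ/n`, in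
coordinates: it acts on the functions on `H`, which is enumerated by `ε`. -/
noncomputable def inducedRep : Representation ℂ (AffineGroup H) (ι → ℂ) where
  toFun g :=
    { toFun := fun f i =>
        (stdAddChar (((ε i : (ZMod n)ˣ) : ZMod n) * toAdd g.left) : ℂ) * f (ε.symm (ε i * g.right))
      map_add' := fun f f' => by ext; simp [mul_add]
      map_smul' := fun r f => by ext; simp [mul_left_comm] }
  map_one' := by ext; simp
  map_mul' g h := by
    ext f i
    simp [toAdd_unitAction, mul_add, AddChar.map_add_eq_mul, mul_assoc]

theorem inducedRep_apply (g : AffineGroup H) (f : ι → ℂ) (i : ι) :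
    inducedRep ε g f i =
      (stdAddChar (((ε i : (ZMod n)ˣ) : ZMod n) * toAdd g.left) : ℂ) * f (ε.symm (ε i * g.right)) := rfl

theorem inducedRep_character [Fintype ι] [Fintype H] [DecidableEq H] (g : AffineGroup H) :
    (inducedRep ε).character g =
      if g.right = 1 then
        ∑ t : H, (stdAddChar (((t : (ZMod n)ˣ) : ZMod n) * toAdd g.left) : ℂ)
      else 0 := by
  classical
  rw [Representation.character, LinearMap.trace_eq_matrix_trace ℂ (Pi.basisFun ℂ ι), Matrix.trace]
  simp only [Matrix.diag_apply, LinearMap.toMatrix_apply, Pi.basisFun_apply, Pi.basisFun_repr,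
    inducedRep_apply]
  split_ifs with h
  · rw [← ε.sum_comp]
    simp [h]
  · refine Finset.sum_eq_zero fun i _ => ?_
    rw [Pi.single_apply, if_neg, mul_zero]
    rw [Equiv.symm_apply_eq, mul_eq_left]
    exact h

theorem inducedRep_inl_single [DecidableEq ι] (i : ι) (x : ZMod n) :
    inducedRep ε (SemidirectProduct.inl (ofAdd x)) (Pi.single i 1) =
      (stdAddChar (((ε i : (ZMod n)ˣ) : ZMod n) * x) : ℂ) • Pi.single i (1 : ℂ) := by
  ext k
  rcases eq_or_ne k i with rfl | hk
  · simp [inducedRep_apply]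
  · simp [inducedRep_apply, hk]

theorem inducedRep_inr_single [DecidableEq ι] (i : ι) (s : H) :
    inducedRep ε (SemidirectProduct.inr s) (Pi.single i 1) =
      Pi.single (ε.symm (ε i * s⁻¹)) (1 : ℂ) := by
  ext k
  have h : ε.symm (ε k * s) = i ↔ k = ε.symm (ε i * s⁻¹) := by
    rw [Equiv.symm_apply_eq, Equiv.eq_symm_apply, eq_mul_inv_iff_mul_eq]
  simp [inducedRep_apply, Pi.single_apply, h]

/-- The Fourier projections of `ℤ/n` onto the coordinate lines. -/
theorem sum_inducedRep_inl [DecidableEq ι] (i : ι) (v : ι → ℂ) :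
    ∑ x : ZMod n, (stdAddChar (-(((ε i : (ZMod n)ˣ) : ZMod n) * x)) : ℂ) •
      inducedRep ε (SemidirectProduct.inl (ofAdd x)) v = (n * v i) • Pi.single i (1 : ℂ) := by
  ext k
  have h (x : ZMod n) : (stdAddChar (-(((ε i : (ZMod n)ˣ) : ZMod n) * x)) : ℂ) *
      stdAddChar (((ε k : (ZMod n)ˣ) : ZMod n) * x) =
        stdAddChar (x * (((ε k : (ZMod n)ˣ) : ZMod n) - ((ε i : (ZMod n)ˣ) : ZMod n))) := by
    rw [← AddChar.map_add_eq_mul]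
    congr 1
    ring
  simp only [Finset.sum_apply, Pi.smul_apply, inducedRep_apply, SemidirectProduct.left_inl,
    SemidirectProduct.right_inl, toAdd_ofAdd, mul_one, Equiv.symm_apply_apply, smul_eq_mul,
    ← mul_assoc, h]
  rw [← Finset.sum_mul, AddChar.sum_mulShift _ (isPrimitive_stdAddChar n), ZMod.card]
  rcases eq_or_ne k i with rfl | hk
  · simp
  · have hne : ((ε k : (ZMod n)ˣ) : ZMod n) - (ε i : (ZMod n)ˣ) ≠ 0 := by
      rw [sub_ne_zero]
      exact fun h => hk (ε.injective (Subtype.ext (Units.ext h)))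
    simp [hne, hk]

theorem inducedRep_isIrreducible [Finite ι] : (inducedRep ε).IsIrreducible := by
  classical
  have : Fintype ι := Fintype.ofFinite ι
  have key (S : Subrepresentation (inducedRep ε)) (v : ι → ℂ) (hv : v ∈ S.toSubmodule)
      (hv0 : v ≠ 0) : S.toSubmodule = ⊤ := by
    obtain ⟨i, hi⟩ := Function.ne_iff.mp hv0
    have h1 : (Pi.single i 1 : ι → ℂ) ∈ S.toSubmodule := by
      have h2 : ((n : ℂ) * v i) • (Pi.single i 1 : ι → ℂ) ∈ S.toSubmodule := by
        rw [← sum_inducedRep_inl ε]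
        exact Submodule.sum_mem _ fun x _ =>
          Submodule.smul_mem _ _ (S.apply_mem_toSubmodule _ hv)
      exact (Submodule.smul_mem_iff _
        (mul_ne_zero (Nat.cast_ne_zero.mpr (NeZero.ne n)) hi)).mp h2
    have h3 (j : ι) : (Pi.single j 1 : ι → ℂ) ∈ S.toSubmodule := by
      have h4 := S.apply_mem_toSubmodule (SemidirectProduct.inr ((ε j)⁻¹ * ε i)) h1
      rw [inducedRep_inr_single] at h4
      simpa using h4
    rw [eq_top_iff]
    intro w _
    rw [pi_eq_sum_univ' w]
    refine Submodule.sum_mem _ fun j _ => Submodule.smul_mem _ _ ?_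
    convert h3 j using 1
  have hne : (⊥ : Subrepresentation (inducedRep ε)) ≠ ⊤ := by
    intro h
    have h1 : (Pi.single (ε.symm 1) 1 : ι → ℂ) ∈
        (⊤ : Subrepresentation (inducedRep ε)).toSubmodule := Submodule.mem_top
    rw [← h] at h1
    exact one_ne_zero (Pi.single_eq_zero_iff.mp ((Submodule.mem_bot ℂ).mp h1))
  have : Nontrivial (Subrepresentation (inducedRep ε)) := ⟨⊥, ⊤, hne⟩
  refine ⟨fun S => ?_⟩
  by_cases h : S.toSubmodule = ⊥
  · exact Or.inl (Subrepresentation.toSubmodule_injective h)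
  · obtain ⟨v, hv, hv0⟩ := Submodule.exists_mem_ne_zero_of_ne_bot h
    exact Or.inr (Subrepresentation.toSubmodule_injective (key S v hv hv0))

instance : Finite (AffineGroup H) := Finite.of_equiv _ SemidirectProduct.equivProd.symm

theorem isSolvable_affineGroup : Group.IsSolvable (AffineGroup H) :=
  Group.isSolvable_of_ker_le_range (SemidirectProduct.inl (φ := unitAction H))
    (SemidirectProduct.rightHom (φ := unitAction H))
    SemidirectProduct.range_inl_eq_ker_rightHom.ge

end SemidirectProduct

/-! ### The normal subgroup of order prime to `p` -/

section Multiples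

variable {n q m : ℕ}

/-- Multiplication by `q` as an embedding of `ℤ/m` in `ℤ/qm`. -/
noncomputable def mulHom (hn : n = q * m) : ZMod m →+ ZMod n :=
  ZMod.lift m ⟨zmultiplesHom (ZMod n) (q : ZMod n), by
    rw [zmultiplesHom_apply, natCast_zsmul, nsmul_eq_mul, ← Nat.cast_mul, mul_comm, ← hn,
      ZMod.natCast_self]⟩

theorem mulHom_intCast (hn : n = q * m) (j : ℤ) : mulHom hn j = q * j := by
  rw [mulHom, ZMod.lift_coe, zmultiplesHom_apply, zsmul_eq_mul, mul_comm]

theorem mulHom_mul (hn : n = q * m) (u : (ZMod n)ˣ) (j : ZMod m) :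
    mulHom hn (ZMod.unitsMap (Dvd.intro_left q hn.symm) u * j) = u * mulHom hn j := by
  obtain ⟨j, rfl⟩ := ZMod.intCast_surjective j
  obtain ⟨k, hk⟩ := ZMod.intCast_surjective (u : ZMod n)
  have h1 : ((ZMod.unitsMap (Dvd.intro_left q hn.symm) u : (ZMod m)ˣ) : ZMod m) = (k : ZMod m) := by
    rw [ZMod.unitsMap_val, ← hk]
    exact ZMod.cast_intCast (Dvd.intro_left q hn.symm) k
  rw [h1, ← hk, ← Int.cast_mul, mulHom_intCast, mulHom_intCast]
  push_cast
  ring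

variable (H : Subgroup (ZMod n)ˣ)

/-- The subgroup of order `m` of the normal subgroup `ℤ/n` of `ℤ/n ⋊ H`. -/
noncomputable def inlMultiples (hn : n = q * m) : Multiplicative (ZMod m) →* AffineGroup H :=
  SemidirectProduct.inl.comp (AddMonoidHom.toMultiplicative (mulHom hn))

/-- The action of `ℤ/n ⋊ H` by conjugation on its subgroup of order `m`. -/
def conjAction (hmn : m ∣ n) : AffineGroup H →* (ZMod m)ˣ :=
  ((ZMod.unitsMap hmn).comp H.subtype).comp SemidirectProduct.rightHom

theorem conj_inlMultiples (hn : n = q * m) (g : AffineGroup H) (j : ZMod m) :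
    g * inlMultiples H hn (ofAdd j) * g⁻¹ =
      inlMultiples H hn (ofAdd (conjAction H (Dvd.intro_left q hn.symm) g * j)) := by
  have h : inlMultiples H hn (ofAdd (conjAction H (Dvd.intro_left q hn.symm) g * j)) =
      SemidirectProduct.inl (ofAdd (((g.right : (ZMod n)ˣ) : ZMod n) * mulHom hn j)) := by
    rw [← mulHom_mul]
    rfl
  rw [h, mul_inv_eq_iff_eq_mul]
  ext
  · rw [SemidirectProduct.mul_left, SemidirectProduct.mul_left, SemidirectProduct.right_inl,
      map_one, MulAut.one_apply]
    exact add_comm (toAdd g.left) (((g.right : (ZMod n)ˣ) : ZMod n) * mulHom hn j)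
  · simp [inlMultiples]

theorem range_conjAction (hmn : m ∣ n) :
    (conjAction H hmn).range = ((ZMod.unitsMap hmn).comp H.subtype).range := by
  rw [conjAction, MonoidHom.range_comp,
    MonoidHom.range_eq_top.mpr SemidirectProduct.rightHom_surjective, MonoidHom.range_eq_map]

variable [NeZero n] [NeZero m]

theorem stdAddChar_mulHom (hn : n = q * m) (j : ZMod m) :
    (stdAddChar (mulHom hn j) : ℂ) = stdAddChar j := by
  obtain ⟨j, rfl⟩ := ZMod.intCast_surjective j
  have hq : q ≠ 0 := by
    rintro rfl
    exact NeZero.ne n (by simpa using hn)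
  have h1 : mulHom hn (j : ZMod m) = ((q * j : ℤ) : ZMod n) := by
    rw [mulHom_intCast]; push_cast; rfl
  rw [h1, stdAddChar_coe, stdAddChar_coe, hn]
  congr 1
  have : (m : ℂ) ≠ 0 := Nat.cast_ne_zero.mpr (NeZero.ne m)
  have : (q : ℂ) ≠ 0 := Nat.cast_ne_zero.mpr hq
  push_cast
  field_simp

theorem mulHom_injective (hn : n = q * m) : Function.Injective (mulHom hn) := by
  intro i j h
  apply injective_stdAddChar
  rw [← stdAddChar_mulHom hn, h, stdAddChar_mulHom]

theorem inlMultiples_injective (hn : n = q * m) : Function.Injective (inlMultiples H hn) :=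
  SemidirectProduct.inl_injective.comp
    (ofAdd.injective.comp ((mulHom_injective hn).comp toAdd.injective))

theorem weightSpace_inducedRep_ne_bot {H : Subgroup (ZMod n)ˣ} {ι : Type*}
    (ε : ι ≃ H) (hn : n = q * m) :
    weightSpace (inducedRep ε) (inlMultiples H hn) 1 ≠ ⊥ := by
  classical
  refine (Submodule.ne_bot_iff _).mpr ⟨Pi.single (ε.symm 1) 1, ?_, ?_⟩
  · rw [weightSpace, End.mem_eigenspace_iff]
    refine (inducedRep_inl_single ε _ (mulHom hn 1)).trans ?_
    simp [stdAddChar_mulHom]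
  · exact fun h => one_ne_zero (Pi.single_eq_zero_iff.mp h)

end Multiples

end HeightZero

/-! ### Subfields of cyclotomic fields -/

namespace HeightZero

open ZMod

section Galois

-- This is the algebra structure used by `IntermediateField.val`; it agrees with
-- `DivisionRing.toRatAlgebra`, which would otherwise be found first, but not reducibly.
noncomputable local instance intermediateFieldAlgebra (L : IntermediateField ℚ ℂ) : Algebra ℚ L :=
  L.algebra'

variable {n : ℕ} [NeZero n]

theorem stdAddChar_mem_cyclotomicSubfield (x : ZMod n) :
    (stdAddChar x : ℂ) ∈ cyclotomicSubfield n := by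
  obtain ⟨k, rfl⟩ := ZMod.natCast_zmod_surjective x
  have h : (stdAddChar (k : ZMod n) : ℂ) = Complex.exp (2 * Real.pi * Complex.I / n) ^ k := by
    have := stdAddChar_coe (N := n) (k : ℤ)
    push_cast at this
    rw [this, ← Complex.exp_nat_mul]
    congr 1
    ring
  rw [h]
  exact pow_mem (IntermediateField.mem_adjoin_simple_self ℚ _) k

instance : IsCyclotomicExtension {n} ℚ (cyclotomicSubfield n) := by
  have hζ := Complex.isPrimitiveRoot_exp n (NeZero.ne n)
  have halg : IsAlgebraic ℚ (Complex.exp (2 * Real.pi * Complex.I / n)) :=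
    ((hζ.isIntegral (NeZero.pos n)).tower_top (A := ℚ)).isAlgebraic
  change IsCyclotomicExtension {n} ℚ (cyclotomicSubfield n).toSubalgebra
  rw [cyclotomicSubfield, IntermediateField.adjoin_simple_toSubalgebra_of_isAlgebraic halg]
  exact hζ.adjoin_isCyclotomicExtension ℚ

instance : FiniteDimensional ℚ (cyclotomicSubfield n) :=
  IsCyclotomicExtension.finiteDimensional {n} ℚ _

instance : IsGalois ℚ (cyclotomicSubfield n) := IsCyclotomicExtension.isGalois {n} ℚ _

/-- The roots of unity `e(x / n)` in the cyclotomic field. -/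
noncomputable def rootOfUnity (x : ZMod n) : cyclotomicSubfield n :=
  ⟨stdAddChar x, stdAddChar_mem_cyclotomicSubfield x⟩

variable (n) in
/-- The isomorphism of the Galois group of the `n`-th cyclotomic field with `(ℤ/n)ˣ`. -/
noncomputable def galEquiv : Gal(cyclotomicSubfield n/ℚ) ≃* (ZMod n)ˣ :=
  IsCyclotomicExtension.autEquivPow (cyclotomicSubfield n)
    (Polynomial.cyclotomic.irreducible_rat (NeZero.pos n))

theorem apply_rootOfUnity (σ : Gal(cyclotomicSubfield n/ℚ)) (x : ZMod n) :
    σ (rootOfUnity x) = rootOfUnity ((galEquiv n σ : ZMod n) * x) := by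
  have hpow (k : ℕ) (y : ZMod n) : rootOfUnity y ^ k = rootOfUnity ((k : ZMod n) * y) := by
    apply Subtype.ext
    change (stdAddChar y : ℂ) ^ k = stdAddChar ((k : ZMod n) * y)
    rw [← nsmul_eq_mul, AddChar.map_nsmul_eq_pow]
  have hζ := IsCyclotomicExtension.zeta_spec n ℚ (cyclotomicSubfield n)
  have h1 : rootOfUnity x ^ n = 1 := by
    rw [hpow]
    exact Subtype.ext (by simp [rootOfUnity])
  obtain ⟨i, -, hi⟩ := hζ.eq_pow_of_pow_eq_one h1
  have hspec := hζ.autToPow_spec ℚ σ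
  have hgal : galEquiv n σ = hζ.autToPow ℚ σ := rfl
  rw [← hgal] at hspec
  rw [← hi, map_pow, ← hspec, ← pow_mul, mul_comm, pow_mul, hi, hpow, ZMod.natCast_val,
    ZMod.cast_id', id]

/-- The group of units of `ℤ/n` corresponding to a subfield `F` of the cyclotomic field. -/
noncomputable def unitsFixing (n : ℕ) [NeZero n] (F : IntermediateField ℚ ℂ) :
    Subgroup (ZMod n)ˣ :=
  (F.comap (cyclotomicSubfield n).val).fixingSubgroup.map (galEquiv n).toMonoidHom

theorem galEquiv_mem_unitsFixing {F : IntermediateField ℚ ℂ}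
    {σ : Gal(cyclotomicSubfield n/ℚ)} :
    galEquiv n σ ∈ unitsFixing n F ↔ σ ∈ (F.comap (cyclotomicSubfield n).val).fixingSubgroup :=
  Subgroup.mem_map_iff_mem (galEquiv n).injective

variable {F : IntermediateField ℚ ℂ} [Fintype (unitsFixing n F)]

/-- The Gaussian period attached to `F`: the trace to `F` of a root of unity. -/
theorem sum_stdAddChar_mem (x : ZMod n) :
    ∑ t : unitsFixing n F, (stdAddChar (((t : (ZMod n)ˣ) : ZMod n) * x) : ℂ) ∈ F := by
  set s : cyclotomicSubfield n := ∑ t : unitsFixing n F,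
    rootOfUnity (((t : (ZMod n)ˣ) : ZMod n) * x) with hs
  have hmem : s ∈ F.comap (cyclotomicSubfield n).val := by
    rw [← IsGalois.fixedField_fixingSubgroup (F.comap (cyclotomicSubfield n).val),
      IntermediateField.mem_fixedField_iff]
    intro σ hσ
    rw [hs, map_sum]
    refine Fintype.sum_equiv (Equiv.mulLeft ⟨galEquiv n σ, galEquiv_mem_unitsFixing.mpr hσ⟩) _ _
      fun t => ?_
    simp [apply_rootOfUnity, mul_assoc]
  have : ((cyclotomicSubfield n).val s : ℂ) ∈ F := hmem
  rw [hs, map_sum] at this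
  exact this

/-- A unit fixing all Gaussian periods attached to `F` fixes `F`, as distinct characters of `ℤ/n`
are linearly independent. -/
theorem mem_unitsFixing_of_sum_eq {u : (ZMod n)ˣ}
    (h : ∀ x : ZMod n,
      ∑ t : unitsFixing n F, (stdAddChar ((u : ZMod n) * (((t : (ZMod n)ˣ) : ZMod n) * x)) : ℂ) =
      ∑ t : unitsFixing n F, (stdAddChar (((t : (ZMod n)ˣ) : ZMod n) * x) : ℂ)) :
    u ∈ unitsFixing n F := by
  by_contra hu
  have h1 (a : ZMod n) : ∑ x : ZMod n, (stdAddChar (-((u : ZMod n) * x)) : ℂ) * stdAddChar (a * x) =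
      if a = u then (n : ℂ) else 0 := by
    have := AddChar.sum_mulShift (a - u) (isPrimitive_stdAddChar n)
    simp only [sub_eq_zero, ZMod.card] at this
    push_cast at this
    rw [← this]
    refine Finset.sum_congr rfl fun x _ => ?_
    rw [← AddChar.map_add_eq_mul]
    congr 1
    ring
  have h2 : ∑ x : ZMod n, (stdAddChar (-((u : ZMod n) * x)) : ℂ) *
      ∑ t : unitsFixing n F, (stdAddChar (((t : (ZMod n)ˣ) : ZMod n) * x) : ℂ) = 0 := by
    simp only [Finset.mul_sum]
    rw [Finset.sum_comm]
    refine Finset.sum_eq_zero fun t _ => ?_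
    rw [h1, if_neg]
    exact fun ht => hu (Units.ext ht ▸ t.2)
  have h3 : ∑ x : ZMod n, (stdAddChar (-((u : ZMod n) * x)) : ℂ) *
      ∑ t : unitsFixing n F, (stdAddChar ((u : ZMod n) * (((t : (ZMod n)ˣ) : ZMod n) * x)) : ℂ) = n := by
    simp only [Finset.mul_sum, ← mul_assoc]
    rw [Finset.sum_comm, Finset.sum_eq_single 1]
    · rw [h1]; simp
    · intro t _ ht
      rw [h1, if_neg]
      intro h
      have h4 : u * (t : (ZMod n)ˣ) = u := Units.ext h
      exact ht (Subtype.ext (by simpa using h4))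
    · simp
  simp only [h, h2] at h3
  exact NeZero.ne n (by exact_mod_cast h3.symm)

theorem le_adjoin_sum_stdAddChar (hF : F ≤ cyclotomicSubfield n) :
    F ≤ IntermediateField.adjoin ℚ (Set.range fun x : ZMod n =>
      ∑ t : unitsFixing n F, (stdAddChar (((t : (ZMod n)ˣ) : ZMod n) * x) : ℂ)) := by
  set E := IntermediateField.adjoin ℚ (Set.range fun x : ZMod n =>
      ∑ t : unitsFixing n F, (stdAddChar (((t : (ZMod n)ˣ) : ZMod n) * x) : ℂ)) with hE
  have hle : F.comap (cyclotomicSubfield n).val ≤ E.comap (cyclotomicSubfield n).val := by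
    rw [← IsGalois.fixedField_fixingSubgroup (F.comap (cyclotomicSubfield n).val),
      ← IsGalois.fixedField_fixingSubgroup (E.comap (cyclotomicSubfield n).val)]
    refine IntermediateField.fixedField_le fun σ hσ => ?_
    rw [← galEquiv_mem_unitsFixing]
    refine mem_unitsFixing_of_sum_eq fun x => ?_
    let s : cyclotomicSubfield n := ∑ t : unitsFixing n F, rootOfUnity (((t : (ZMod n)ˣ) : ZMod n) * x)
    have hs : (cyclotomicSubfield n).val s =
        ∑ t : unitsFixing n F, (stdAddChar (((t : (ZMod n)ˣ) : ZMod n) * x) : ℂ) := map_sum _ _ _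
    have hsE : s ∈ E.comap (cyclotomicSubfield n).val := by
      change (cyclotomicSubfield n).val s ∈ E
      rw [hs]
      exact IntermediateField.subset_adjoin ℚ _ ⟨x, rfl⟩
    have hσs := (IntermediateField.mem_fixingSubgroup_iff _ _).mp hσ s hsE
    rw [← hs, ← hσs]
    simp only [s, map_sum, apply_rootOfUnity]
    rfl
  intro z hz
  exact hle (x := ⟨z, hF hz⟩) hz

omit [Fintype (unitsFixing n F)] in
/-- The units fixing `F` and congruent to `1` modulo `m` embed in the Galois group over the
compositum of `F` with the `m`-th cyclotomic field. -/
theorem card_ker_dvd_relfinrank {m q : ℕ} (hF : F ≤ cyclotomicSubfield n) (hn : n = q * m) :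
    Nat.card ((ZMod.unitsMap (Dvd.intro_left q hn.symm)).comp (unitsFixing n F).subtype).ker ∣
      IntermediateField.relfinrank (F ⊔ cyclotomicSubfield m) (cyclotomicSubfield n) := by
  set K := F ⊔ cyclotomicSubfield m
  set π := (ZMod.unitsMap (Dvd.intro_left q hn.symm)).comp (unitsFixing n F).subtype
  have hcard : Nat.card (K.comap (cyclotomicSubfield n).val).fixingSubgroup =
      IntermediateField.relfinrank K (cyclotomicSubfield n) := by
    rw [IsGalois.card_fixingSubgroup_eq_finrank, ← IntermediateField.relfinrank_top_right,
      ← IntermediateField.relfinrank_comap_comap_eq_relfinrank_of_le K (cyclotomicSubfield n)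
        (cyclotomicSubfield n).val (by simp)]
    congr 1
    ext x
    exact iff_of_true IntermediateField.mem_top x.2
  rw [← hcard]
  have hm : (m : ℂ) ≠ 0 := by
    rintro h
    exact NeZero.ne n (by simp [hn, Nat.cast_eq_zero.mp h])
  have hq : (q : ℂ) ≠ 0 := by
    rintro h
    exact NeZero.ne n (by simp [hn, Nat.cast_eq_zero.mp h])
  have hmem (u : π.ker) : (galEquiv n).symm ((u : unitsFixing n F) : (ZMod n)ˣ) ∈
      (K.comap (cyclotomicSubfield n).val).fixingSubgroup := by
    obtain ⟨⟨u, huF⟩, hu⟩ := u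
    obtain ⟨σ, rfl⟩ := (galEquiv n).surjective u
    rw [MulEquiv.symm_apply_apply]
    have hσF := galEquiv_mem_unitsFixing.mp huF
    have hKle : K ≤ IntermediateField.lift (IntermediateField.fixedField (Subgroup.zpowers σ)) := by
      have hmem_lift (z : cyclotomicSubfield n) (hz : σ z = z) :
          (z : ℂ) ∈ IntermediateField.lift
            (IntermediateField.fixedField (Subgroup.zpowers σ)) := by
        rw [IntermediateField.mem_lift, IntermediateField.mem_fixedField_iff]
        intro τ hτ
        have : Subgroup.zpowers σ ≤ MulAction.stabilizer _ z :=
          (Subgroup.zpowers_le).mpr (by simpa using hz)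
        exact this hτ
      refine sup_le (fun z hz => ?_) (IntermediateField.adjoin_simple_le_iff.mpr ?_)
      · exact hmem_lift ⟨z, hF hz⟩
          ((IntermediateField.mem_fixingSubgroup_iff _ _).mp hσF _ hz)
      · have hroot : Complex.exp (2 * Real.pi * Complex.I / m) =
            (rootOfUnity ((q : ℤ) : ZMod n) : cyclotomicSubfield n) := by
          change _ = (stdAddChar ((q : ℤ) : ZMod n) : ℂ)
          rw [stdAddChar_coe, hn]
          congr 1
          push_cast
          field_simp
        rw [hroot]
        refine hmem_lift _ ?_
        rw [apply_rootOfUnity]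
        congr 1
        obtain ⟨k, hk⟩ := ZMod.intCast_surjective (galEquiv n σ : ZMod n)
        have hk1 : ((k : ℤ) : ZMod m) = 1 := by
          have h1 : ZMod.unitsMap (Dvd.intro_left q hn.symm) (galEquiv n σ) = 1 := hu
          have h2 := congrArg Units.val h1
          rw [ZMod.unitsMap_val, ← hk] at h2
          rw [← ZMod.cast_intCast (Dvd.intro_left q hn.symm) k, h2, Units.val_one]
        have hdvd : (m : ℤ) ∣ k - 1 := by
          rw [← ZMod.intCast_zmod_eq_zero_iff_dvd]
          push_cast
          rw [hk1, sub_self]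
        obtain ⟨l, hl⟩ := hdvd
        rw [← hk, ← Int.cast_mul, ← sub_eq_zero, ← Int.cast_sub,
          ZMod.intCast_zmod_eq_zero_iff_dvd]
        exact ⟨l, by rw [hn]; push_cast; linear_combination (q : ℤ) * hl⟩
    rw [IntermediateField.mem_fixingSubgroup_iff]
    intro z hz
    have := hKle hz
    exact (IntermediateField.mem_fixedField_iff _ _).mp
      ((IntermediateField.mem_lift z).mp this) σ (Subgroup.mem_zpowers σ)
  refine Subgroup.card_dvd_of_injective
    ((((galEquiv n).symm.toMonoidHom.comp (unitsFixing n F).subtype).comp π.ker.subtype).codRestrict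
      _ hmem) ?_
  refine Function.Injective.of_comp (f := Subtype.val) ?_
  exact (galEquiv n).symm.injective.comp (Subtype.val_injective.comp Subtype.val_injective)

end Galois

end HeightZero

/-! ### Heights -/

namespace HeightZero

open Module

/-- An irreducible character has height zero if the `p`-part of its degree divides all degrees in
its block. -/
theorem Irr.hasHeightZero_of_forall_le {G : Type*} [Group G] {p : ℕ} {χ : Irr G}
    (h : ∀ M : Ideal (integralClosure ℤ ℂ), M.IsMaximal → (p : integralClosure ℤ ℂ) ∈ M →
      ∀ ψ ∈ χ.block M, padicValNat p χ.degree ≤ padicValNat p ψ.degree) :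
    χ.HasHeightZero p := by
  intro M hM hpM
  obtain ⟨ψ, hψ, hmin⟩ := Nat.sInf_mem
    (s := (fun ψ : Irr G => padicValNat p ψ.degree) '' χ.block M) ⟨_, χ, χ.mem_block_self M, rfl⟩
  rw [height, ← hmin]
  exact Nat.sub_eq_zero_of_le (h M hM hpM ψ hψ)

/-- The induced character has height zero if the group of the units in `H` that centralize the
subgroup of order `m` has order prime to `p`. -/
theorem hasHeightZero_inducedRep {n q m d p : ℕ} [NeZero n] [NeZero m] (hp : p.Prime)
    (hn : n = q * m) (hpm : ¬ p ∣ m) {H : Subgroup (ZMod n)ˣ} (ε : Fin d ≃ H)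
    (hker : ¬ p ∣ Nat.card ((ZMod.unitsMap (Dvd.intro_left q hn.symm)).comp H.subtype).ker)
    {χ : Irr (AffineGroup H)} (hχ : χ.1 = (inducedRep ε).character) :
    χ.HasHeightZero p := by
  have : Fact p.Prime := ⟨hp⟩
  have hrange := range_conjAction H (Dvd.intro_left q hn.symm)
  set f := (ZMod.unitsMap (Dvd.intro_left q hn.symm)).comp H.subtype
  have hdeg : χ.degree = Nat.card f.range * Nat.card f.ker := by
    have h1 : (χ.degree : ℂ) = d := by
      rw [← χ.apply_one, hχ, Representation.char_one]
      simp
    have h2 : d = Nat.card H := by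
      rw [← Nat.card_congr ε, Nat.card_fin]
    rw [Nat.cast_injective h1, h2, ← Subgroup.index_ker, mul_comm, Subgroup.card_mul_index]
  refine Irr.hasHeightZero_of_forall_le fun M hM hpM ψ hψ => ?_
  obtain ⟨e, τ, hτ, hψτ⟩ := ψ.2
  have hnt : Nontrivial (Fin e → ℂ) := by
    by_contra hnt
    rw [not_nontrivial_iff_subsingleton] at hnt
    have := hτ.toNontrivial
    obtain ⟨S, T, hST⟩ := exists_pair_ne (Subrepresentation τ)
    exact hST (Subrepresentation.toSubmodule_injective (Subsingleton.elim _ _))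
  have hψe : ψ.degree = finrank ℂ (Fin e → ℂ) := by
    have h1 : (ψ.degree : ℂ) = finrank ℂ (Fin e → ℂ) := by
      rw [← ψ.apply_one, hψτ, Representation.char_one]
    exact_mod_cast h1
  have hconj := conj_inlMultiples H hn
  obtain ⟨y, hy⟩ := exists_weightSpace_ne_bot τ (inlMultiples H hn)
  obtain ⟨g, rfl⟩ := weight_mem_range_of_congr hconj (inlMultiples_injective H hn)
    (inducedRep_isIrreducible ε) hτ hM hp hpm hpM
    (by rw [← hχ, ← hψτ]; exact hψ)
    (weightSpace_inducedRep_ne_bot ε hn) hy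
  have h1 : weightSpace τ (inlMultiples H hn) 1 ≠ ⊥ := by
    rw [← Submodule.one_le_finrank_iff, finrank_weightSpace_eq hconj g] at hy
    rwa [← Submodule.one_le_finrank_iff]
  -- `ψ(1)` is divisible by the index in `H` of the centralizer of the subgroup of order `m`, and
  -- `χ(1)` is the product of this index with the order of the centralizer, which is prime to `p`.
  have hdvd := card_range_dvd_finrank hconj hτ h1
  rw [hrange, ← hψe] at hdvd
  have hψ0 : ψ.degree ≠ 0 := hψe ▸ finrank_pos.ne'
  rw [hdeg, padicValNat.mul Nat.card_pos.ne' Nat.card_pos.ne',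
    padicValNat.eq_zero_of_not_dvd hker, add_zero]
  exact padicValNat_dvd_iff_le hψ0 |>.mp (pow_padicValNat_dvd.trans hdvd)

/-- The field of values of the character induced from a faithful character of `ℤ/n` to the
semidirect product with the Galois group over `F` is generated by the Gaussian periods of `F`. -/
theorem fieldOfValues_inducedRep {n d : ℕ} [NeZero n] {F : IntermediateField ℚ ℂ}
    (hF : F ≤ cyclotomicSubfield n) (ε : Fin d ≃ unitsFixing n F)
    {χ : Irr (AffineGroup (unitsFixing n F))} (hχ : χ.1 = (inducedRep ε).character) :
    χ.fieldOfValues = F := by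
  classical
  have : Fintype (unitsFixing n F) := Fintype.ofFinite _
  rw [Irr.fieldOfValues, hχ]
  apply le_antisymm
  · rw [IntermediateField.adjoin_le_iff]
    rintro _ ⟨g, rfl⟩
    rw [inducedRep_character]
    split_ifs
    · exact sum_stdAddChar_mem _
    · exact zero_mem F
  · refine (le_adjoin_sum_stdAddChar hF).trans (IntermediateField.adjoin.mono ℚ _ _ ?_)
    rintro _ ⟨x, rfl⟩
    exact ⟨SemidirectProduct.inl (Multiplicative.ofAdd x),
      (inducedRep_character ε _).trans (if_pos rfl)⟩

end HeightZero

theorem theoremG (p : ℕ) (hp : p.Prime) (F : IntermediateField ℚ ℂ) (n a m : ℕ)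
    (hF : HeightZero.IsConductor F n) (hn : n = p ^ a * m) (hm : ¬ p ∣ m)
    (hdeg : ¬ p ∣ IntermediateField.relfinrank
      (F ⊔ HeightZero.cyclotomicSubfield m) (HeightZero.cyclotomicSubfield n)) :
    ∃ (G : Type) (_ : Group G) (_ : Finite G) (_ : Group.IsSolvable G) (χ : HeightZero.Irr G),
      χ.HasHeightZero p ∧ χ.fieldOfValues = F := by
  obtain ⟨hn0, hFn⟩ := hF.1
  have : NeZero n := ⟨hn0.ne'⟩
  have : NeZero m := ⟨fun h => hm (h ▸ dvd_zero p)⟩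
  let ε := (Finite.equivFin (HeightZero.unitsFixing n F)).symm
  refine ⟨HeightZero.AffineGroup (HeightZero.unitsFixing n F), inferInstance, inferInstance,
    HeightZero.isSolvable_affineGroup,
    ⟨(HeightZero.inducedRep ε).character, _, HeightZero.inducedRep ε,
      HeightZero.inducedRep_isIrreducible ε, rfl⟩, ?_, ?_⟩
  · exact HeightZero.hasHeightZero_inducedRep hp hn hm ε
      (fun h => hdeg (h.trans (HeightZero.card_ker_dvd_relfinrank hFn hn))) rfl
  · exact HeightZero.fieldOfValues_inducedRep hFn ε rfl
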